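/- Let $\Sigma\subset\mathbb R^3$ be a cyclic surface, that is, an immersed surface swept out by a smooth one-parameter family of circles: $\Sigma$ is parametrized by an immersion $$X(s,\theta)=c(s)+r(s)\,(\cos\theta\,u(s)+\sin\theta\,v(s)),\qquad s\in I,\ \theta\in\mathbb R,$$ where $I\subset\mathbb R$ is a non-empty open interval, $c,u,v\colon I\to\mathbb R^3$ and $r\colon I\to(0,\infty)$ are smooth, and $u(s),v(s)$ are orthonormal for each $s$. The planes $c(s)+\operatorname{span}\{u(s),v(s)\}$ are called the planes of the foliation. Let $\nu=(\nu_1,\nu_2,\nu_3)=X_s\times X_\theta/|X_s\times X_\theta|$ be the unit normal of $\Sigma$ and let $H$ be its mean curvature (half the trace of the second fundamental form $\langle\nu,d^2X\rangle$). The Dirichlet energy is $\int_\Sigma F(\nu)\,d\Sigma$ with $F(\nu)=\frac1{\nu_3}-\nu_3$, and its anisotropic mean curvature is $2HF(\nu)-\operatorname{div}_\Sigma\big(DF(\nu)\big)$, where $DF$ is the gradient of $F$ on the unit sphere $\mathbb S^2$. Assume that $\Sigma$ is a CAMC surface of the Dirichlet energy, that is, $\nu_3\neq0$ everywhere on $\Sigma$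 and the anisotropic mean curvature is equal to a constant $\Lambda$. If $\Lambda\neq0$, then all planes of the foliation are parallel to each other. If, in addition, these planes are parallel to the $xy$-plane, then $\Sigma$ is a surface of revolution about an axis parallel to the $z$-axis: there is a vertical line that contains the centres of all the circles, is orthogonal to all planes of the foliation, and is such that $\Sigma$ is invariant under every rotation about it. -/

import Mathlib

open scoped ContDiff

noncomputable section

/-- Euclidean space `ℝ³`. -/
abbrev E3 : Type := EuclideanSpace ℝ (Fin 3)

/-- The vertical unit vector `e₃ = (0, 0, 1)`. -/
def e3 : E3 := EuclideanSpace.single 2 1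

/-! ### Parametrized surfaces in `ℝ³`

A parametrization is a map `X : ℝ → ℝ → E3`, `(s, θ) ↦ X s θ`, which is only looked at on an open
set of parameters where it is smooth. -/

namespace ParamSurface

/-- Partial derivative in the first parameter of a map with values in `ℝ³`. -/
def d1 (V : ℝ → ℝ → E3) (s θ : ℝ) : E3 := deriv (fun σ => V σ θ) s

/-- Partial derivative in the second parameter of a map with values in `ℝ³`. -/
def d2 (V : ℝ → ℝ → E3) (s θ : ℝ) : E3 := deriv (fun τ => V s τ) θ

/-- The vector product of `ℝ³`. -/
def cross (v w : E3) : E3 := WithLp.toLp 2 (crossProduct (WithLp.ofLp v) (WithLp.ofLp w))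

/-- The immersion condition at a point. -/
def IsImmersedAt (X : ℝ → ℝ → E3) (s θ : ℝ) : Prop :=
  LinearIndependent ℝ ![d1 X s θ, d2 X s θ]

/-- The unit normal (Gauss map) `ν = X_s × X_θ / |X_s × X_θ|`. -/
def unitNormal (X : ℝ → ℝ → E3) (s θ : ℝ) : E3 :=
  ‖cross (d1 X s θ) (d2 X s θ)‖⁻¹ • cross (d1 X s θ) (d2 X s θ)

/-- Coefficients of the first fundamental form. -/
def g11 (X : ℝ → ℝ → E3) (s θ : ℝ) : ℝ := inner ℝ (d1 X s θ) (d1 X s θ)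
def g12 (X : ℝ → ℝ → E3) (s θ : ℝ) : ℝ := inner ℝ (d1 X s θ) (d2 X s θ)
def g22 (X : ℝ → ℝ → E3) (s θ : ℝ) : ℝ := inner ℝ (d2 X s θ) (d2 X s θ)

/-- Determinant of the first fundamental form. -/
def detG (X : ℝ → ℝ → E3) (s θ : ℝ) : ℝ := g11 X s θ * g22 X s θ - g12 X s θ ^ 2

/-- Coefficients of the second fundamental form with respect to `ν`. -/
def h11 (X : ℝ → ℝ → E3) (s θ : ℝ) : ℝ := inner ℝ (unitNormal X s θ) (d1 (d1 X) s θ)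
def h12 (X : ℝ → ℝ → E3) (s θ : ℝ) : ℝ := inner ℝ (unitNormal X s θ) (d2 (d1 X) s θ)
def h22 (X : ℝ → ℝ → E3) (s θ : ℝ) : ℝ := inner ℝ (unitNormal X s θ) (d2 (d2 X) s θ)

/-- The mean curvature `H`: half of the trace of the second fundamental form. -/
def meanCurvature (X : ℝ → ℝ → E3) (s θ : ℝ) : ℝ :=
  (g22 X s θ * h11 X s θ - 2 * g12 X s θ * h12 X s θ + g11 X s θ * h22 X s θ) / (2 * detG X s θ)

/-- The divergence `div_Σ V = ∑ gⁱʲ ⟨∂ᵢ V, ∂ⱼ X⟩` along the surface `X` of a field `V`. -/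
def surfaceDiv (X V : ℝ → ℝ → E3) (s θ : ℝ) : ℝ :=
  (g22 X s θ * inner ℝ (d1 V s θ) (d1 X s θ)
    - g12 X s θ * (inner ℝ (d1 V s θ) (d2 X s θ) + inner ℝ (d2 V s θ) (d1 X s θ))
    + g11 X s θ * inner ℝ (d2 V s θ) (d2 X s θ)) / detG X s θ

/-- The gradient on the unit sphere at `ν` of (the restriction of) a function `F` that is
differentiable near `ν` in `ℝ³`: the part of the gradient in `ℝ³` tangent to the sphere. -/
def sphereGrad (F : E3 → ℝ) (ν : E3) : E3 :=
  gradient F ν - (inner ℝ (gradient F ν) ν : ℝ) • ν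

/-- The anisotropic mean curvature `2 H F(ν) - div_Σ (DF(ν))` of the energy `∫_Σ F(ν) dΣ`. -/
def anisotropicMeanCurvature (F : E3 → ℝ) (X : ℝ → ℝ → E3) (s θ : ℝ) : ℝ :=
  2 * meanCurvature X s θ * F (unitNormal X s θ)
    - surfaceDiv X (fun σ τ => sphereGrad F (unitNormal X σ τ)) s θ

end ParamSurface

/-- The integrand `F(ν) = 1/ν₃ - ν₃` of the Dirichlet energy, used only where `ν₃ ≠ 0`. -/
def dirichletIntegrand (ν : E3) : ℝ := 1 / ν 2 - ν 2

/-- A cyclic surface: an immersed surface swept out by a smooth one-parameter family of circles.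
The circle with parameter `s` has centre `c s` and radius `r s`, and lies in the plane through
`c s` spanned by the orthonormal vectors `u s`, `v s`. The parameter runs over an open interval
`I`, bounded or not. -/
structure CyclicSurface where
  I : Set ℝ
  c : ℝ → E3
  r : ℝ → ℝ
  u : ℝ → E3
  v : ℝ → E3
  isOpen_I : IsOpen I
  ordConnected_I : I.OrdConnected
  nonempty_I : I.Nonempty
  smooth_c : ContDiffOn ℝ ∞ c I
  smooth_r : ContDiffOn ℝ ∞ r I
  smooth_u : ContDiffOn ℝ ∞ u I
  smooth_v : ContDiffOn ℝ ∞ v I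
  r_pos : ∀ s ∈ I, 0 < r s
  orthonormal : ∀ s ∈ I, Orthonormal ℝ ![u s, v s]
  immersed : ∀ s ∈ I, ∀ θ : ℝ, ParamSurface.IsImmersedAt
    (fun σ τ => c σ + r σ • (Real.cos τ • u σ + Real.sin τ • v σ)) s θ

namespace CyclicSurface

/-- The parametrization `X(s, θ) = c(s) + r(s) (cos θ u(s) + sin θ v(s))`. -/
def X (S : CyclicSurface) (s θ : ℝ) : E3 :=
  S.c s + S.r s • (Real.cos θ • S.u s + Real.sin θ • S.v s)

/-- The points of the surface. -/
def carrier (S : CyclicSurface) : Set E3 := {x | ∃ s ∈ S.I, ∃ θ : ℝ, x = S.X s θ}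

/-- The plane of the foliation that contains the circle with parameter `s`. -/
def plane (S : CyclicSurface) (s : ℝ) : AffineSubspace ℝ E3 :=
  AffineSubspace.mk' (S.c s) (Submodule.span ℝ {S.u s, S.v s})

/-- `S` has constant anisotropic mean curvature `Λ` for the Dirichlet energy. The integrand is
defined for `ν₃ ≠ 0` only, which is part of the condition. -/
def IsDirichletCAMC (S : CyclicSurface) (Λ : ℝ) : Prop :=
  ∀ s ∈ S.I, ∀ θ : ℝ, ParamSurface.unitNormal S.X s θ 2 ≠ 0 ∧
    ParamSurface.anisotropicMeanCurvature dirichletIntegrand S.X s θ = Λ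

/-- `S` is a surface of revolution about the line through `p` with direction `d`: it is invariant
under every rotation about that line, and its circles are coaxial, that is, their centres lie on
the line and their planes are orthogonal to it. -/
def IsSurfaceOfRevolutionAbout (S : CyclicSurface) (p d : E3) : Prop :=
  d ≠ 0 ∧
  (∀ ρ : E3 ≃ₗᵢ[ℝ] E3, LinearMap.det (ρ.toLinearEquiv : E3 →ₗ[ℝ] E3) = 1 → ρ d = d →
    (fun x => p + ρ (x - p)) '' S.carrier = S.carrier) ∧
  (∀ s ∈ S.I, S.c s ∈ AffineSubspace.mk' p (Submodule.span ℝ {d}) ∧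
    (S.plane s).direction = (Submodule.span ℝ {d})ᗮ)

end CyclicSurface

/-- The `xy`-plane. -/
def xyPlane : AffineSubspace ℝ E3 := AffineSubspace.mk' 0 (Submodule.span ℝ {e3})ᗮ

end

/-!
For the graph of `f` one has `F(ν) dΣ = |∇f|² dx dy`, so the anisotropic mean curvature of the
Dirichlet energy is `2 Δf`. Let `N = X_s × X_θ`. On each circle `N₃` is a trigonometric polynomial
in `θ` of degree at most two, and `N₃³ Δf` is one of degree at most five. Hence
`N₃³ Δf = (Λ / 2) N₃³` with `Λ ≠ 0` forces the Fourier coefficients of `N₃` at the frequencies `±2`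
to vanish. This says that the product of the complex numbers `⟨u', n⟩ + i ⟨v', n⟩` and `u₃ + i v₃`
is zero, where `n = u × v`: wherever the plane is not horizontal, its normal `n` is stationary.

If all planes are horizontal, then `N₃³ Δf` has degree at most two while `N₃` has degree at most
one, so the coefficients of `N₃` at `±1` vanish as well; they are the horizontal components of the
velocity of the centre, up to a factor. The argument takes place on one circle at a time, so `Λ`
may depend on `s`.
-/

open Filter Polynomial
open scoped InnerProductSpace Topology

namespace E3

theorem inner_eq (x y : E3) : ⟪x, y⟫_ℝ = x 0 * y 0 + x 1 * y 1 + x 2 * y 2 := by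
  simp only [PiLp.inner_apply, Fin.sum_univ_three, RCLike.inner_apply, conj_trivial, mul_comm]

theorem inner_e3_left (x : E3) : ⟪e3, x⟫_ℝ = x 2 := by
  simp [inner_eq, e3]

theorem mem_span_e3_iff {x : E3} : x ∈ Submodule.span ℝ {e3} ↔ x 0 = 0 ∧ x 1 = 0 := by
  rw [Submodule.mem_span_singleton]
  constructor
  · rintro ⟨h, rfl⟩
    simp [e3]
  · rintro ⟨h0, h1⟩
    refine ⟨x 2, ?_⟩
    ext i
    fin_cases i <;> simp [e3, h0, h1]

theorem hasDerivAt_apply {f : ℝ → E3} {f' : E3} {t : ℝ} (h : HasDerivAt f f' t) (i : Fin 3) :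
    HasDerivAt (fun x => f x i) (f' i) t :=
  (EuclideanSpace.proj (𝕜 := ℝ) i : E3 →L[ℝ] ℝ).hasFDerivAt.comp_hasDerivAt t h

end E3

section InnerDerivative

variable {E : Type*} [NormedAddCommGroup E] [InnerProductSpace ℝ E] {f g : ℝ → E} {f' g' : E}
  {t k : ℝ}

theorem inner_deriv_eq_neg (hf : HasDerivAt f f' t) (hg : HasDerivAt g g' t)
    (h : ∀ᶠ x in 𝓝 t, ⟪f x, g x⟫_ℝ = k) : ⟪f', g t⟫_ℝ = -⟪f t, g'⟫_ℝ := by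
  have h_const := (hasDerivAt_const t k).congr_of_eventuallyEq h
  linarith [(hf.inner ℝ hg).unique h_const]

theorem inner_deriv_self_eq_zero (hf : HasDerivAt f f' t) (h : ∀ᶠ x in 𝓝 t, ‖f x‖ = k) :
    ⟪f', f t⟫_ℝ = 0 := by
  have h_inner : ∀ᶠ x in 𝓝 t, ⟪f x, f x⟫_ℝ = k ^ 2 := by
    filter_upwards [h] with x hx
    rw [real_inner_self_eq_norm_sq, hx]
  linarith [inner_deriv_eq_neg hf hf h_inner, real_inner_comm f' (f t)]

theorem differentiableAt_normalize (hf : DifferentiableAt ℝ f t) (h : f t ≠ 0) :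
    DifferentiableAt ℝ (fun x => NormedSpace.normalize (f x)) t :=
  ((hf.norm ℝ h).fun_inv (norm_ne_zero_iff.2 h)).fun_smul hf

end InnerDerivative

namespace ParamSurface

section Cross

theorem cross_apply_zero (x y : E3) : cross x y 0 = x 1 * y 2 - x 2 * y 1 := by
  simp [cross, crossProduct]

theorem cross_apply_one (x y : E3) : cross x y 1 = x 2 * y 0 - x 0 * y 2 := by
  simp [cross, crossProduct]

theorem cross_apply_two (x y : E3) : cross x y 2 = x 0 * y 1 - x 1 * y 0 := by
  simp [cross, crossProduct]

theorem inner_cross_left (a b : E3) : ⟪cross a b, a⟫_ℝ = 0 := by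
  rw [E3.inner_eq, cross_apply_zero, cross_apply_one, cross_apply_two]; ring

theorem inner_cross_right (a b : E3) : ⟪cross a b, b⟫_ℝ = 0 := by
  rw [E3.inner_eq, cross_apply_zero, cross_apply_one, cross_apply_two]; ring

theorem inner_cross_cross_self (a b : E3) :
    ⟪cross a b, cross a b⟫_ℝ = ⟪a, a⟫_ℝ * ⟪b, b⟫_ℝ - ⟪a, b⟫_ℝ ^ 2 := by
  simp only [E3.inner_eq, cross_apply_zero, cross_apply_one, cross_apply_two]; ring

theorem cross_cross_left_apply_two (a b : E3) :
    cross (cross a b) a 2 = ⟪a, a⟫_ℝ * b 2 - ⟪a, b⟫_ℝ * a 2 := by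
  simp only [E3.inner_eq, cross_apply_zero, cross_apply_one, cross_apply_two]; ring

theorem cross_cross_right_apply_two (a b : E3) :
    cross (cross a b) b 2 = ⟪a, b⟫_ℝ * b 2 - ⟪b, b⟫_ℝ * a 2 := by
  simp only [E3.inner_eq, cross_apply_zero, cross_apply_one, cross_apply_two]; ring

theorem cross_ne_zero {a b : E3} (h : LinearIndependent ℝ ![a, b]) : cross a b ≠ 0 := by
  have h_ofLp : LinearIndependent ℝ ![WithLp.ofLp a, WithLp.ofLp b] := by
    rw [LinearIndependent.pair_iff] at h ⊢
    exact fun x y hxy => h x y (by ext i; simpa using congrFun hxy i)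
  intro h_zero
  exact crossProduct_ne_zero_iff_linearIndependent.2 h_ofLp
    (by simpa [cross] using congrArg WithLp.ofLp h_zero)

theorem inner_cross_cross_self_smul (a b x : E3) :
    ⟪cross a b, cross a b⟫_ℝ • x
      = ⟪x, cross a b⟫_ℝ • cross a b + (⟪b, b⟫_ℝ * ⟪x, a⟫_ℝ - ⟪a, b⟫_ℝ * ⟪x, b⟫_ℝ) • a
        + (⟪a, a⟫_ℝ * ⟪x, b⟫_ℝ - ⟪a, b⟫_ℝ * ⟪x, a⟫_ℝ) • b := by
  ext i
  fin_cases i <;>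
  · simp only [Fin.zero_eta, Fin.mk_one, Fin.reduceFinMk, PiLp.add_apply, PiLp.smul_apply,
      smul_eq_mul, E3.inner_eq, cross_apply_zero, cross_apply_one, cross_apply_two]
    ring

theorem differentiableAt_cross {a b : ℝ → E3} {t : ℝ} (ha : DifferentiableAt ℝ a t)
    (hb : DifferentiableAt ℝ b t) : DifferentiableAt ℝ (fun x => cross (a x) (b x)) t := by
  rw [differentiableAt_euclidean] at ha hb ⊢
  intro i
  fin_cases i
  · simpa only [Fin.zero_eta, cross_apply_zero] using
      ((ha 1).fun_mul (hb 2)).fun_sub ((ha 2).fun_mul (hb 1))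
  · simpa only [Fin.mk_one, cross_apply_one] using
      ((ha 2).fun_mul (hb 0)).fun_sub ((ha 0).fun_mul (hb 2))
  · simpa only [Fin.reduceFinMk, cross_apply_two] using
      ((ha 0).fun_mul (hb 1)).fun_sub ((ha 1).fun_mul (hb 0))

end Cross

section UnitNormal

/-- `X` is twice differentiable at `(s, θ)` in the sense needed for the second fundamental form:
its first partial derivatives have partial derivatives there, and the mixed ones agree. -/
structure TwiceDifferentiableAt (X : ℝ → ℝ → E3) (s θ : ℝ) : Prop where
  d1_d1 : DifferentiableAt ℝ (fun σ => d1 X σ θ) s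
  d2_d1 : DifferentiableAt ℝ (fun τ => d1 X s τ) θ
  d1_d2 : DifferentiableAt ℝ (fun σ => d2 X σ θ) s
  d2_d2 : DifferentiableAt ℝ (fun τ => d2 X s τ) θ
  symm : d1 (d2 X) s θ = d2 (d1 X) s θ

theorem deriv_normalize_cross {a b : ℝ → E3} {t : ℝ} (ha : DifferentiableAt ℝ a t)
    (hb : DifferentiableAt ℝ b t) (h : cross (a t) (b t) ≠ 0) {ν : ℝ → E3}
    (hν : ν = fun x => NormedSpace.normalize (cross (a x) (b x))) :
    HasDerivAt ν (deriv ν t) t ∧ ⟪deriv ν t, ν t⟫_ℝ = 0 ∧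
      ⟪deriv ν t, a t⟫_ℝ = -⟪ν t, deriv a t⟫_ℝ ∧ ⟪deriv ν t, b t⟫_ℝ = -⟪ν t, deriv b t⟫_ℝ := by
  have h_cross := differentiableAt_cross ha hb
  have h_diff : HasDerivAt ν (deriv ν t) t :=
    hν ▸ (differentiableAt_normalize h_cross h).hasDerivAt
  refine ⟨h_diff, ?_, ?_, ?_⟩
  · refine inner_deriv_self_eq_zero (k := 1) h_diff ?_
    filter_upwards [h_cross.continuousAt.eventually_ne h] with x hx
    rw [hν, NormedSpace.norm_normalize_eq_one_iff.2 hx]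
  · refine inner_deriv_eq_neg (k := 0) h_diff ha.hasDerivAt (.of_forall fun x => ?_)
    simp only [hν, NormedSpace.normalize, real_inner_smul_left, inner_cross_left, mul_zero]
  · refine inner_deriv_eq_neg (k := 0) h_diff hb.hasDerivAt (.of_forall fun x => ?_)
    simp only [hν, NormedSpace.normalize, real_inner_smul_left, inner_cross_right, mul_zero]

variable {X : ℝ → ℝ → E3} {s θ : ℝ}

theorem inner_unitNormal_d1 : ⟪unitNormal X s θ, d1 X s θ⟫_ℝ = 0 := by
  rw [unitNormal, real_inner_smul_left, inner_cross_left, mul_zero]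

theorem inner_unitNormal_d2 : ⟪unitNormal X s θ, d2 X s θ⟫_ℝ = 0 := by
  rw [unitNormal, real_inner_smul_left, inner_cross_right, mul_zero]

theorem cross_eq_norm_smul_unitNormal :
    cross (d1 X s θ) (d2 X s θ) = ‖cross (d1 X s θ) (d2 X s θ)‖ • unitNormal X s θ :=
  (NormedSpace.norm_smul_normalize _).symm

theorem detG_eq_norm_sq : detG X s θ = ‖cross (d1 X s θ) (d2 X s θ)‖ ^ 2 := by
  rw [← real_inner_self_eq_norm_sq, inner_cross_cross_self, detG, g11, g12, g22]

theorem detG_smul_eq_of_tangent {x : E3} (hx : ⟪x, unitNormal X s θ⟫_ℝ = 0) :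
    detG X s θ • x
      = (g22 X s θ * ⟪x, d1 X s θ⟫_ℝ - g12 X s θ * ⟪x, d2 X s θ⟫_ℝ) • d1 X s θ
        + (g11 X s θ * ⟪x, d2 X s θ⟫_ℝ - g12 X s θ * ⟪x, d1 X s θ⟫_ℝ) • d2 X s θ := by
  rw [detG, g11, g12, g22, ← inner_cross_cross_self, inner_cross_cross_self_smul,
    cross_eq_norm_smul_unitNormal, real_inner_smul_right, hx, mul_zero, zero_smul, zero_add]

theorem deriv_unitNormal_d1 (hX : TwiceDifferentiableAt X s θ) (himm : IsImmersedAt X s θ) :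
    HasDerivAt (fun σ => unitNormal X σ θ) (d1 (unitNormal X) s θ) s ∧
      ⟪d1 (unitNormal X) s θ, unitNormal X s θ⟫_ℝ = 0 ∧
      ⟪d1 (unitNormal X) s θ, d1 X s θ⟫_ℝ = -h11 X s θ ∧
      ⟪d1 (unitNormal X) s θ, d2 X s θ⟫_ℝ = -h12 X s θ := by
  rw [h11, h12, ← hX.symm]
  exact deriv_normalize_cross hX.d1_d1 hX.d1_d2 (cross_ne_zero himm) rfl

theorem deriv_unitNormal_d2 (hX : TwiceDifferentiableAt X s θ) (himm : IsImmersedAt X s θ) :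
    HasDerivAt (fun τ => unitNormal X s τ) (d2 (unitNormal X) s θ) θ ∧
      ⟪d2 (unitNormal X) s θ, unitNormal X s θ⟫_ℝ = 0 ∧
      ⟪d2 (unitNormal X) s θ, d1 X s θ⟫_ℝ = -h12 X s θ ∧
      ⟪d2 (unitNormal X) s θ, d2 X s θ⟫_ℝ = -h22 X s θ :=
  deriv_normalize_cross hX.d2_d1 hX.d2_d2 (cross_ne_zero himm) rfl

end UnitNormal

section HeightIntegrand

theorem gradient_comp_height {f : ℝ → ℝ} {f' : ℝ} {ν : E3} (hf : HasDerivAt f f' (ν 2)) :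
    gradient (fun x : E3 => f (x 2)) ν = f' • e3 := by
  apply HasGradientAt.gradient
  rw [hasGradientAt_iff_hasFDerivAt]
  refine (hf.comp_hasFDerivAt ν
    (EuclideanSpace.proj (𝕜 := ℝ) 2 : E3 →L[ℝ] ℝ).hasFDerivAt).congr_fderiv ?_
  ext x
  simp [E3.inner_e3_left]

theorem sphereGrad_comp_height {f : ℝ → ℝ} {f' : ℝ} {ν : E3} (hf : HasDerivAt f f' (ν 2)) :
    sphereGrad (fun x => f (x 2)) ν = f' • (e3 - ν 2 • ν) := by
  rw [sphereGrad, gradient_comp_height hf, real_inner_smul_left, E3.inner_e3_left, smul_sub,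
    smul_smul]

variable {f g : ℝ → ℝ} {g' : ℝ}

theorem inner_deriv_sphereGrad_comp_height {ν : ℝ → E3} {ν' x : E3} {t : ℝ}
    (hf : ∀ᶠ z in 𝓝 (ν t 2), HasDerivAt f (g z) z) (hg : HasDerivAt g g' (ν t 2))
    (hν : HasDerivAt ν ν' t) (hx : ⟪ν t, x⟫_ℝ = 0) :
    ⟪deriv (fun y => sphereGrad (fun z => f (z 2)) (ν y)) t, x⟫_ℝ
      = g' * (ν' 2 * x 2) - ν t 2 * g (ν t 2) * ⟪ν', x⟫_ℝ := by
  have h_height := E3.hasDerivAt_apply hν 2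
  have h_grad : (fun y => sphereGrad (fun z => f (z 2)) (ν y))
      =ᶠ[𝓝 t] fun y => g (ν y 2) • (e3 - ν y 2 • ν y) :=
    (h_height.continuousAt.eventually hf).mono fun y hy => sphereGrad_comp_height hy
  have h_deriv := (hg.comp t h_height).fun_smul ((h_height.fun_smul hν).const_sub e3)
  rw [h_grad.deriv_eq]
  refine (congrArg (⟪·, x⟫_ℝ) h_deriv.deriv).trans ?_
  simp only [Function.comp_apply, inner_add_left, inner_sub_left, inner_neg_left,
    real_inner_smul_left, E3.inner_e3_left, hx]
  ring

theorem anisotropicMeanCurvature_comp_height {X : ℝ → ℝ → E3} {s θ : ℝ}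
    (hX : TwiceDifferentiableAt X s θ) (himm : IsImmersedAt X s θ)
    (hf : ∀ᶠ z in 𝓝 (unitNormal X s θ 2), HasDerivAt f (g z) z)
    (hg : HasDerivAt g g' (unitNormal X s θ 2)) :
    anisotropicMeanCurvature (fun x => f (x 2)) X s θ * detG X s θ
      = (f (unitNormal X s θ 2) - unitNormal X s θ 2 * g (unitNormal X s θ 2))
          * (g22 X s θ * h11 X s θ - 2 * g12 X s θ * h12 X s θ + g11 X s θ * h22 X s θ)
        - g' * (g22 X s θ * (d1 (unitNormal X) s θ 2 * d1 X s θ 2)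
          - g12 X s θ * (d1 (unitNormal X) s θ 2 * d2 X s θ 2
            + d2 (unitNormal X) s θ 2 * d1 X s θ 2)
          + g11 X s θ * (d2 (unitNormal X) s θ 2 * d2 X s θ 2)) := by
  obtain ⟨hν₁, -, h₁₁, h₁₂⟩ := deriv_unitNormal_d1 hX himm
  obtain ⟨hν₂, -, h₂₁, h₂₂⟩ := deriv_unitNormal_d2 hX himm
  set V : ℝ → ℝ → E3 := fun σ τ => sphereGrad (fun x => f (x 2)) (unitNormal X σ τ) with hV
  have h_div₁ {x : E3} (hx : ⟪unitNormal X s θ, x⟫_ℝ = 0) : ⟪d1 V s θ, x⟫_ℝ = _ :=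
    inner_deriv_sphereGrad_comp_height (ν := fun σ => unitNormal X σ θ) hf hg hν₁ hx
  have h_div₂ {x : E3} (hx : ⟪unitNormal X s θ, x⟫_ℝ = 0) : ⟪d2 V s θ, x⟫_ℝ = _ :=
    inner_deriv_sphereGrad_comp_height (ν := fun τ => unitNormal X s τ) hf hg hν₂ hx
  have h_detG : detG X s θ ≠ 0 := by
    rw [detG_eq_norm_sq]
    exact pow_ne_zero 2 (norm_ne_zero_iff.2 (cross_ne_zero himm))
  rw [anisotropicMeanCurvature, meanCurvature, surfaceDiv, ← hV,
    h_div₁ inner_unitNormal_d1, h_div₁ inner_unitNormal_d2, h_div₂ inner_unitNormal_d1,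
    h_div₂ inner_unitNormal_d2, h₁₁, h₁₂, h₂₁, h₂₂]
  field_simp
  ring

end HeightIntegrand

section Dirichlet

/-- The numerator of the Laplacian of the height over the `xy`-plane: if `a = X_s`, `b = X_θ` and
`xss`, `xsθ`, `xθθ` are the second derivatives of `X`, then this is `(a × b)₃³ Δf`, where `f` is the
function whose graph is the surface. -/
noncomputable def heightLaplacian (a b xss xsθ xθθ : E3) : ℝ :=
  ⟪cross a b, xss⟫_ℝ * (b 0 ^ 2 + b 1 ^ 2)
    - 2 * ⟪cross a b, xsθ⟫_ℝ * (a 0 * b 0 + a 1 * b 1)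
    + ⟪cross a b, xθθ⟫_ℝ * (a 0 ^ 2 + a 1 ^ 2)

theorem anisotropicMeanCurvature_dirichlet_mul_detG {X : ℝ → ℝ → E3} {s θ : ℝ}
    (hX : TwiceDifferentiableAt X s θ) (himm : IsImmersedAt X s θ)
    (h0 : unitNormal X s θ 2 ≠ 0) :
    anisotropicMeanCurvature dirichletIntegrand X s θ * detG X s θ * unitNormal X s θ 2 ^ 3
      = 2 * (unitNormal X s θ 2 ^ 2
          * (g22 X s θ * h11 X s θ - 2 * g12 X s θ * h12 X s θ + g11 X s θ * h22 X s θ)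
        - (g22 X s θ * (d1 (unitNormal X) s θ 2 * d1 X s θ 2)
          - g12 X s θ * (d1 (unitNormal X) s θ 2 * d2 X s θ 2
            + d2 (unitNormal X) s θ 2 * d1 X s θ 2)
          + g11 X s θ * (d2 (unitNormal X) s θ 2 * d2 X s θ 2))) := by
  have hf : ∀ᶠ z in 𝓝 (unitNormal X s θ 2),
      HasDerivAt (fun z : ℝ => 1 / z - z) (-(z ^ 2)⁻¹ - 1) z := by
    filter_upwards [eventually_ne_nhds h0] with z hz
    simpa only [one_div] using (hasDerivAt_inv hz).fun_sub (hasDerivAt_id' z)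
  have hg : HasDerivAt (fun z : ℝ => -(z ^ 2)⁻¹ - 1) (2 / unitNormal X s θ 2 ^ 3)
      (unitNormal X s θ 2) := by
    refine (((hasDerivAt_pow 2 (unitNormal X s θ 2)).fun_inv
      (pow_ne_zero 2 h0)).fun_neg.sub_const 1).congr_deriv ?_
    push_cast
    field_simp
  change anisotropicMeanCurvature (fun x => 1 / x 2 - x 2) X s θ * _ * _ = _
  rw [anisotropicMeanCurvature_comp_height (f := fun z => 1 / z - z) hX himm hf hg]
  field_simp
  ring

/-- The scalar identity behind `2 H F(ν) - div DF(ν) = 2 Δf`: here `W² = det g`, `n = ν₃`, the `zᵢ`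
are the derivatives of the height, and the `mᵢ` are those of `ν₃`, given by the Weingarten
equations. -/
theorem weingarten_trace_eq {W n g₁₁ g₁₂ g₂₂ h₁₁ h₁₂ h₂₂ z₁ z₂ m₁ m₂ : ℝ} (hW : W ≠ 0)
    (h_det : g₁₁ * g₂₂ - g₁₂ ^ 2 = W ^ 2)
    (h_flat : (W * n) ^ 2 = (g₁₁ - z₁ ^ 2) * (g₂₂ - z₂ ^ 2) - (g₁₂ - z₁ * z₂) ^ 2)
    (hm₁ : W ^ 2 * m₁ = (g₁₂ * h₁₂ - g₂₂ * h₁₁) * z₁ + (g₁₂ * h₁₁ - g₁₁ * h₁₂) * z₂)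
    (hm₂ : W ^ 2 * m₂ = (g₁₂ * h₂₂ - g₂₂ * h₁₂) * z₁ + (g₁₂ * h₁₂ - g₁₁ * h₂₂) * z₂) :
    n ^ 2 * (g₂₂ * h₁₁ - 2 * g₁₂ * h₁₂ + g₁₁ * h₂₂)
        - (g₂₂ * (m₁ * z₁) - g₁₂ * (m₁ * z₂ + m₂ * z₁) + g₁₁ * (m₂ * z₂))
      = h₁₁ * (g₂₂ - z₂ ^ 2) - 2 * h₁₂ * (g₁₂ - z₁ * z₂) + h₂₂ * (g₁₁ - z₁ ^ 2) := by
  refine mul_left_cancel₀ (pow_ne_zero 2 hW) ?_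
  linear_combination (g₂₂ * h₁₁ - 2 * g₁₂ * h₁₂ + g₁₁ * h₂₂) * h_flat
    - (g₂₂ * z₁ - g₁₂ * z₂) * hm₁ - (g₁₁ * z₂ - g₁₂ * z₁) * hm₂
    + (h₁₁ * (g₂₂ - z₂ ^ 2) - 2 * h₁₂ * (g₁₂ - z₁ * z₂) + h₂₂ * (g₁₁ - z₁ ^ 2)) * h_det

theorem anisotropicMeanCurvature_dirichlet {X : ℝ → ℝ → E3} {s θ : ℝ}
    (hX : TwiceDifferentiableAt X s θ) (himm : IsImmersedAt X s θ)
    (h0 : unitNormal X s θ 2 ≠ 0) :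
    anisotropicMeanCurvature dirichletIntegrand X s θ * cross (d1 X s θ) (d2 X s θ) 2 ^ 3
      = 2 * heightLaplacian (d1 X s θ) (d2 X s θ) (d1 (d1 X) s θ) (d2 (d1 X) s θ)
          (d2 (d2 X) s θ) := by
  obtain ⟨-, h_tangent₁, h₁₁, h₁₂⟩ := deriv_unitNormal_d1 hX himm
  obtain ⟨-, h_tangent₂, h₂₁, h₂₂⟩ := deriv_unitNormal_d2 hX himm
  have h_weingarten₁ := congrArg (fun x : E3 => x 2) (detG_smul_eq_of_tangent h_tangent₁)
  have h_weingarten₂ := congrArg (fun x : E3 => x 2) (detG_smul_eq_of_tangent h_tangent₂)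
  have h_curvature := anisotropicMeanCurvature_dirichlet_mul_detG hX himm h0
  have h_detG := detG_eq_norm_sq (X := X) (s := s) (θ := θ)
  have h_normal := cross_eq_norm_smul_unitNormal (X := X) (s := s) (θ := θ)
  have hW : ‖cross (d1 X s θ) (d2 X s θ)‖ ≠ 0 := norm_ne_zero_iff.2 (cross_ne_zero himm)
  set W := ‖cross (d1 X s θ) (d2 X s θ)‖
  have h_normal₂ : cross (d1 X s θ) (d2 X s θ) 2 = W * unitNormal X s θ 2 := by
    rw [h_normal, PiLp.smul_apply, smul_eq_mul]
  -- The metric of the projection to the `xy`-plane is `g - dz ⊗ dz`, of determinant `(W ν₃)²`.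
  have h_flat₁ : d1 X s θ 0 ^ 2 + d1 X s θ 1 ^ 2 = g11 X s θ - d1 X s θ 2 ^ 2 := by
    rw [g11, E3.inner_eq]; ring
  have h_flat₂ : d2 X s θ 0 ^ 2 + d2 X s θ 1 ^ 2 = g22 X s θ - d2 X s θ 2 ^ 2 := by
    rw [g22, E3.inner_eq]; ring
  have h_flat₁₂ : d1 X s θ 0 * d2 X s θ 0 + d1 X s θ 1 * d2 X s θ 1
      = g12 X s θ - d1 X s θ 2 * d2 X s θ 2 := by
    rw [g12, E3.inner_eq]; ring
  have h_flat_det : (W * unitNormal X s θ 2) ^ 2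
      = (g11 X s θ - d1 X s θ 2 ^ 2) * (g22 X s θ - d2 X s θ 2 ^ 2)
        - (g12 X s θ - d1 X s θ 2 * d2 X s θ 2) ^ 2 := by
    rw [← h_normal₂, ← h_flat₁, ← h_flat₂, ← h_flat₁₂, cross_apply_two]; ring
  simp only [PiLp.smul_apply, PiLp.add_apply, smul_eq_mul, h₁₁, h₁₂, h₂₁, h₂₂, h_detG]
    at h_weingarten₁ h_weingarten₂ h_curvature
  rw [weingarten_trace_eq hW h_detG h_flat_det (by linear_combination h_weingarten₁)
    (by linear_combination h_weingarten₂)] at h_curvature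
  rw [heightLaplacian, h_flat₁, h_flat₂, h_flat₁₂, h_normal₂, h_normal, real_inner_smul_left,
    real_inner_smul_left, real_inner_smul_left, ← h11, ← h12, ← h22]
  linear_combination W * h_curvature

end Dirichlet

end ParamSurface

/-- `f` is a real trigonometric polynomial of degree at most `n` with Fourier coefficient `c` at
frequency `-n`: multiplied by `exp (i n θ)` it becomes a polynomial in `exp (i θ)` with constant
term `c`. No bound on the other side is imposed, since for real `f` the Fourier coefficients at
opposite frequencies are conjugate. -/
def HasLeadingFourierCoeff (n : ℕ) (f : ℝ → ℝ) (c : ℂ) : Prop :=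
  ∃ P : ℂ[X], P.eval 0 = c ∧ ∀ θ : ℝ, (Circle.exp θ : ℂ) ^ n * f θ = P.eval (Circle.exp θ : ℂ)

namespace HasLeadingFourierCoeff

variable {m n : ℕ} {f g : ℝ → ℝ} {b c : ℂ}

theorem const (x : ℝ) : HasLeadingFourierCoeff 0 (fun _ => x) x :=
  ⟨C (x : ℂ), eval_C, fun θ => by rw [pow_zero, one_mul, eval_C]⟩

theorem add (hf : HasLeadingFourierCoeff n f b) (hg : HasLeadingFourierCoeff n g c) :
    HasLeadingFourierCoeff n (fun θ => f θ + g θ) (b + c) := by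
  obtain ⟨P, rfl, hP⟩ := hf
  obtain ⟨Q, rfl, hQ⟩ := hg
  refine ⟨P + Q, eval_add, fun θ => ?_⟩
  rw [eval_add, ← hP, ← hQ, Complex.ofReal_add, mul_add]

theorem mul (hf : HasLeadingFourierCoeff m f b) (hg : HasLeadingFourierCoeff n g c) :
    HasLeadingFourierCoeff (m + n) (fun θ => f θ * g θ) (b * c) := by
  obtain ⟨P, rfl, hP⟩ := hf
  obtain ⟨Q, rfl, hQ⟩ := hg
  refine ⟨P * Q, eval_mul, fun θ => ?_⟩
  rw [eval_mul, ← hP, ← hQ, Complex.ofReal_mul]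
  ring

theorem const_mul (x : ℝ) (hf : HasLeadingFourierCoeff n f c) :
    HasLeadingFourierCoeff n (fun θ => x * f θ) (x * c) := by
  simpa only [zero_add] using (const x).mul hf

theorem sub (hf : HasLeadingFourierCoeff n f b) (hg : HasLeadingFourierCoeff n g c) :
    HasLeadingFourierCoeff n (fun θ => f θ - g θ) (b - c) := by
  simpa [sub_eq_add_neg] using hf.add (hg.const_mul (-1))

theorem pow (hf : HasLeadingFourierCoeff n f c) (k : ℕ) :
    HasLeadingFourierCoeff (n * k) (fun θ => f θ ^ k) (c ^ k) := by
  induction k with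
  | zero => simpa only [pow_zero, mul_zero, Complex.ofReal_one] using const 1
  | succ k ih => simpa only [pow_succ, mul_add_one] using ih.mul hf

theorem raise (hf : HasLeadingFourierCoeff m f c) (h : m < n) : HasLeadingFourierCoeff n f 0 := by
  obtain ⟨P, -, hP⟩ := hf
  obtain ⟨k, rfl⟩ := Nat.exists_eq_add_of_lt h
  refine ⟨X ^ (k + 1) * P, by simp, fun θ => ?_⟩
  rw [eval_mul, eval_pow, eval_X, ← hP]
  ring

theorem unique (hb : HasLeadingFourierCoeff n f b) (hc : HasLeadingFourierCoeff n f c) :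
    b = c := by
  obtain ⟨P, rfl, hP⟩ := hb
  obtain ⟨Q, rfl, hQ⟩ := hc
  congr 1
  refine eq_of_infinite_eval_eq P Q ?_
  refine Set.infinite_of_injOn_mapsTo (f := fun θ : ℝ => (Circle.exp θ : ℂ))
    (s := Set.Icc 0 Real.pi) ?_ ?_ (Set.Icc_infinite Real.pi_pos)
  · intro x hx y hy hxy
    refine Real.injOn_cos hx hy ?_
    simpa [Complex.exp_ofReal_mul_I_re] using congrArg Complex.re hxy
  · intro θ _
    exact (hP θ).symm.trans (hQ θ)

theorem eq_zero_of_mul_cube (hf : HasLeadingFourierCoeff n f c) {k : ℝ} (hk : k ≠ 0)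
    (h : HasLeadingFourierCoeff (n * 3) (fun θ => k * f θ ^ 3) 0) : c = 0 := by
  simpa [hk] using ((hf.pow 3).const_mul k).unique h

theorem linear (x y z : ℝ) :
    HasLeadingFourierCoeff 1 (fun θ => x + (Real.cos θ * y + Real.sin θ * z))
      ((y + z * Complex.I) / 2) := by
  refine ⟨C (x : ℂ) * X + C ((y - z * Complex.I) / 2) * X ^ 2 + C ((y + z * Complex.I) / 2),
    by simp, fun θ => ?_⟩
  have h_circle : (Real.cos θ : ℂ) ^ 2 + (Real.sin θ : ℂ) ^ 2 = 1 := by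
    exact_mod_cast Real.cos_sq_add_sin_sq θ
  simp only [Circle.coe_exp, Complex.exp_mul_I, ← Complex.ofReal_cos, ← Complex.ofReal_sin,
    eval_add, eval_mul, eval_C, eval_X, eval_pow, Complex.ofReal_add, Complex.ofReal_mul, pow_one]
  linear_combination ((y + z * Complex.I) / 2) * h_circle
    + (Real.cos θ * Real.sin θ * z
      - (Real.sin θ : ℂ) ^ 2 * (y - z * Complex.I) / 2) * Complex.I_sq

open ParamSurface

protected theorem cross {a b : ℝ → E3} {α β : Fin 3 → ℂ}
    (ha : ∀ i, HasLeadingFourierCoeff m (fun θ => a θ i) (α i))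
    (hb : ∀ i, HasLeadingFourierCoeff n (fun θ => b θ i) (β i)) (i : Fin 3) :
    HasLeadingFourierCoeff (m + n) (fun θ => cross (a θ) (b θ) i) (crossProduct α β i) := by
  fin_cases i
  · simpa [cross_apply_zero, crossProduct] using ((ha 1).mul (hb 2)).sub ((ha 2).mul (hb 1))
  · simpa [cross_apply_one, crossProduct] using ((ha 2).mul (hb 0)).sub ((ha 0).mul (hb 2))
  · simpa [cross_apply_two, crossProduct] using ((ha 0).mul (hb 1)).sub ((ha 1).mul (hb 0))

protected theorem inner {a b : ℝ → E3} {α β : Fin 3 → ℂ}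
    (ha : ∀ i, HasLeadingFourierCoeff m (fun θ => a θ i) (α i))
    (hb : ∀ i, HasLeadingFourierCoeff n (fun θ => b θ i) (β i)) :
    HasLeadingFourierCoeff (m + n) (fun θ => ⟪a θ, b θ⟫_ℝ)
      (α 0 * β 0 + α 1 * β 1 + α 2 * β 2) := by
  simpa only [E3.inner_eq] using
    (((ha 0).mul (hb 0)).add ((ha 1).mul (hb 1))).add ((ha 2).mul (hb 2))

protected theorem heightLaplacian {a b xss xsθ xθθ : ℝ → E3} {α β γ δ ε : Fin 3 → ℂ}
    (ha : ∀ i, HasLeadingFourierCoeff 1 (fun θ => a θ i) (α i))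
    (hb : ∀ i, HasLeadingFourierCoeff 1 (fun θ => b θ i) (β i))
    (hss : ∀ i, HasLeadingFourierCoeff 1 (fun θ => xss θ i) (γ i))
    (hsθ : ∀ i, HasLeadingFourierCoeff 1 (fun θ => xsθ θ i) (δ i))
    (hθθ : ∀ i, HasLeadingFourierCoeff 1 (fun θ => xθθ θ i) (ε i)) :
    HasLeadingFourierCoeff 6
      (fun θ => heightLaplacian (a θ) (b θ) (xss θ) (xsθ θ) (xθθ θ)) 0 := by
  have h_normal := HasLeadingFourierCoeff.cross ha hb
  have hss' := (HasLeadingFourierCoeff.inner h_normal hss).mul (((hb 0).pow 2).add ((hb 1).pow 2))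
  have hsθ' := ((HasLeadingFourierCoeff.inner h_normal hsθ).const_mul 2).mul
    (((ha 0).mul (hb 0)).add ((ha 1).mul (hb 1)))
  have hθθ' := (HasLeadingFourierCoeff.inner h_normal hθθ).mul (((ha 0).pow 2).add ((ha 1).pow 2))
  exact ((hss'.sub hsθ').add hθθ').raise (by norm_num)

end HasLeadingFourierCoeff

/-- The parametrized ellipse `f + cos θ • g + sin θ • h`, a vector-valued trigonometric polynomial
of degree one. -/
noncomputable def trigVec (f g h : E3) (θ : ℝ) : E3 := f + (Real.cos θ • g + Real.sin θ • h)

section TrigVec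

theorem trigVec_apply (f g h : E3) (θ : ℝ) (i : Fin 3) :
    trigVec f g h θ i = f i + (Real.cos θ * g i + Real.sin θ * h i) := rfl

theorem hasLeadingFourierCoeff_trigVec (f g h : E3) (i : Fin 3) :
    HasLeadingFourierCoeff 1 (fun θ => trigVec f g h θ i) ((g i + h i * Complex.I) / 2) :=
  .linear (f i) (g i) (h i)

theorem hasDerivAt_trigVec (f g h : E3) (θ : ℝ) :
    HasDerivAt (trigVec f g h) (trigVec 0 h (-g) θ) θ := by
  refine ((((Real.hasDerivAt_cos θ).smul_const g).fun_add
    ((Real.hasDerivAt_sin θ).smul_const h)).const_add f).congr_deriv ?_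
  rw [trigVec]
  module

theorem hasDerivAt_trigVec_coeff {f g h : ℝ → E3} {f' g' h' : E3} {s : ℝ}
    (hf : HasDerivAt f f' s) (hg : HasDerivAt g g' s) (hh : HasDerivAt h h' s) (θ : ℝ) :
    HasDerivAt (fun σ => trigVec (f σ) (g σ) (h σ) θ) (trigVec f' g' h' θ) s :=
  hf.fun_add ((hg.fun_const_smul _).fun_add (hh.fun_const_smul _))

end TrigVec

section Orthonormal

variable {E : Type*} [NormedAddCommGroup E] [InnerProductSpace ℝ E] {u v w : E}

theorem orthonormal_pair_iff : Orthonormal ℝ ![u, v] ↔ ‖u‖ = 1 ∧ ‖v‖ = 1 ∧ ⟪u, v⟫_ℝ = 0 := by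
  simp [orthonormal_vecCons_iff, and_comm, and_left_comm]

theorem norm_sq_smul_add_smul_of_orthonormal (h : Orthonormal ℝ ![u, v]) (x y : ℝ) :
    ‖x • u + y • v‖ ^ 2 = x ^ 2 + y ^ 2 := by
  obtain ⟨hu, hv, huv⟩ := orthonormal_pair_iff.1 h
  rw [norm_add_sq_real, real_inner_smul_left, real_inner_smul_right, huv, norm_smul, norm_smul,
    hu, hv]
  simp

theorem exists_eq_cos_smul_add_sin_smul_iff (h : Orthonormal ℝ ![u, v]) :
    (∃ θ : ℝ, w = Real.cos θ • u + Real.sin θ • v) ↔ w ∈ Submodule.span ℝ {u, v} ∧ ‖w‖ = 1 := by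
  constructor
  · rintro ⟨θ, rfl⟩
    refine ⟨Submodule.mem_span_pair.2 ⟨_, _, rfl⟩, ?_⟩
    rw [← pow_eq_one_iff_of_nonneg (norm_nonneg _) two_ne_zero,
      norm_sq_smul_add_smul_of_orthonormal h, Real.cos_sq_add_sin_sq]
  · rintro ⟨hw, h_norm⟩
    obtain ⟨x, y, rfl⟩ := Submodule.mem_span_pair.1 hw
    have h_complex : ‖(⟨x, y⟩ : ℂ)‖ = 1 := by
      rw [← pow_eq_one_iff_of_nonneg (norm_nonneg _) two_ne_zero, Complex.sq_norm,
        Complex.normSq_mk, ← sq, ← sq, ← norm_sq_smul_add_smul_of_orthonormal h, h_norm, one_pow]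
    obtain ⟨θ, hθ⟩ := (Complex.norm_eq_one_iff _).1 h_complex
    refine ⟨θ, ?_⟩
    rw [← Complex.exp_ofReal_mul_I_re, ← Complex.exp_ofReal_mul_I_im, hθ]

end Orthonormal

namespace ParamSurface

variable {u v : E3}

theorem norm_cross_of_orthonormal (h : Orthonormal ℝ ![u, v]) : ‖cross u v‖ = 1 := by
  obtain ⟨hu, hv, huv⟩ := orthonormal_pair_iff.1 h
  rw [← pow_eq_one_iff_of_nonneg (norm_nonneg _) two_ne_zero, ← real_inner_self_eq_norm_sq,
    inner_cross_cross_self, real_inner_self_eq_norm_sq, real_inner_self_eq_norm_sq, hu, hv, huv]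
  norm_num

theorem eq_sum_of_orthonormal (h : Orthonormal ℝ ![u, v]) (x : E3) :
    x = ⟪x, cross u v⟫_ℝ • cross u v + ⟪x, u⟫_ℝ • u + ⟪x, v⟫_ℝ • v := by
  obtain ⟨hu, hv, huv⟩ := orthonormal_pair_iff.1 h
  simpa [norm_cross_of_orthonormal h, hu, hv, huv] using inner_cross_cross_self_smul u v x

theorem cross_left_apply_two_of_orthonormal (h : Orthonormal ℝ ![u, v]) (x : E3) :
    cross x u 2 = ⟪x, cross u v⟫_ℝ * v 2 - ⟪x, v⟫_ℝ * cross u v 2 := by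
  obtain ⟨hu, -, huv⟩ := orthonormal_pair_iff.1 h
  have h_cross := cross_cross_left_apply_two u v
  have h_sum (i : Fin 3) := congrArg (fun y : E3 => y i) (eq_sum_of_orthonormal h x)
  rw [huv, real_inner_self_eq_norm_sq, hu] at h_cross
  simp only [cross_apply_two _ u, cross_apply_two u, PiLp.add_apply, PiLp.smul_apply,
    smul_eq_mul] at h_cross h_sum ⊢
  linear_combination u 1 * h_sum 0 - u 0 * h_sum 1 + ⟪x, cross u v⟫_ℝ * h_cross

theorem cross_right_apply_two_of_orthonormal (h : Orthonormal ℝ ![u, v]) (x : E3) :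
    cross x v 2 = ⟪x, u⟫_ℝ * cross u v 2 - ⟪x, cross u v⟫_ℝ * u 2 := by
  obtain ⟨-, hv, huv⟩ := orthonormal_pair_iff.1 h
  have h_cross := cross_cross_right_apply_two u v
  have h_sum (i : Fin 3) := congrArg (fun y : E3 => y i) (eq_sum_of_orthonormal h x)
  rw [huv, real_inner_self_eq_norm_sq, hv] at h_cross
  simp only [cross_apply_two _ v, PiLp.add_apply, PiLp.smul_apply,
    smul_eq_mul] at h_cross h_sum ⊢
  linear_combination v 1 * h_sum 0 - v 0 * h_sum 1 + ⟪x, cross u v⟫_ℝ * h_cross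

theorem span_pair_eq_orthogonal_cross (h : Orthonormal ℝ ![u, v]) :
    Submodule.span ℝ {u, v} = (Submodule.span ℝ {cross u v})ᗮ := by
  apply le_antisymm
  · rw [Submodule.span_le]
    rintro x (rfl | rfl) <;>
      rw [SetLike.mem_coe, Submodule.mem_orthogonal_singleton_iff_inner_right]
    exacts [inner_cross_left _ _, inner_cross_right _ _]
  · intro x hx
    rw [Submodule.mem_orthogonal_singleton_iff_inner_left] at hx
    rw [eq_sum_of_orthonormal h x, hx, zero_smul, zero_add]
    exact Submodule.mem_span_pair.2 ⟨_, _, rfl⟩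

theorem cross_apply_two_sq_add (h : Orthonormal ℝ ![u, v]) :
    cross u v 2 ^ 2 + u 2 ^ 2 + v 2 ^ 2 = 1 := by
  have h_e3 := congrArg (fun x : E3 => x 2) (eq_sum_of_orthonormal h e3)
  have h_one : e3 2 = 1 := by simp [e3]
  simp only [E3.inner_e3_left, PiLp.add_apply, PiLp.smul_apply, smul_eq_mul, h_one] at h_e3
  linarith

end ParamSurface

open ParamSurface

theorem hasDerivAt_deriv_of_contDiffOn {E : Type*} [NormedAddCommGroup E] [NormedSpace ℝ E]
    {f : ℝ → E} {I : Set ℝ} {s : ℝ} (hf : ContDiffOn ℝ ∞ f I) (hI : IsOpen I) (hs : s ∈ I) :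
    HasDerivAt f (deriv f s) s :=
  ((hf.differentiableOn (by simp)).differentiableAt (hI.mem_nhds hs)).hasDerivAt

theorem eq_of_hasDerivAt_zero {E : Type*} [NormedAddCommGroup E] [NormedSpace ℝ E]
    {f : ℝ → E} {I : Set ℝ} (hI : IsOpen I) (hI' : I.OrdConnected)
    (hf : ∀ s ∈ I, HasDerivAt f 0 s) {s t : ℝ} (hs : s ∈ I) (ht : t ∈ I) : f s = f t :=
  hI.is_const_of_deriv_eq_zero hI'.isPreconnected
    (fun x hx => (hf x hx).differentiableAt.differentiableWithinAt)
    (fun x hx => (hf x hx).deriv) hs ht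

namespace CyclicSurface

/-- The radius vector of the circle at `θ = 0`. -/
def p (S : CyclicSurface) (s : ℝ) : E3 := S.r s • S.u s

/-- The radius vector of the circle at `θ = π / 2`. -/
def q (S : CyclicSurface) (s : ℝ) : E3 := S.r s • S.v s

/-- The unit normal of the plane of the circle. -/
def n (S : CyclicSurface) (s : ℝ) : E3 := cross (S.u s) (S.v s)

variable (S : CyclicSurface) {s : ℝ}

section Parametrization

theorem X_eq_trigVec : S.X = fun s => trigVec (S.c s) (S.p s) (S.q s) := by
  ext1 s
  ext1 θ
  simp only [X, trigVec, p, q, smul_add, smul_comm (S.r s)]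

theorem smooth_p : ContDiffOn ℝ ∞ S.p S.I := S.smooth_r.smul S.smooth_u

theorem smooth_q : ContDiffOn ℝ ∞ S.q S.I := S.smooth_r.smul S.smooth_v

theorem d1_X (hs : s ∈ S.I) :
    d1 S.X s = trigVec (deriv S.c s) (deriv S.p s) (deriv S.q s) := by
  ext1 θ
  rw [X_eq_trigVec]
  exact (hasDerivAt_trigVec_coeff (hasDerivAt_deriv_of_contDiffOn S.smooth_c S.isOpen_I hs)
    (hasDerivAt_deriv_of_contDiffOn S.smooth_p S.isOpen_I hs)
    (hasDerivAt_deriv_of_contDiffOn S.smooth_q S.isOpen_I hs) θ).deriv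

theorem d2_X (s : ℝ) : d2 S.X s = trigVec 0 (S.q s) (-S.p s) := by
  ext1 θ
  rw [X_eq_trigVec]
  exact (hasDerivAt_trigVec _ _ _ θ).deriv

theorem hasDerivAt_d1_X_fst (hs : s ∈ S.I) (θ : ℝ) :
    HasDerivAt (fun σ => d1 S.X σ θ)
      (trigVec (deriv (deriv S.c) s) (deriv (deriv S.p) s) (deriv (deriv S.q) s) θ) s := by
  have h_deriv {f : ℝ → E3} (hf : ContDiffOn ℝ ∞ f S.I) :
      HasDerivAt (deriv f) (deriv (deriv f) s) s :=
    hasDerivAt_deriv_of_contDiffOn (hf.deriv_of_isOpen S.isOpen_I (by simp)) S.isOpen_I hs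
  refine (hasDerivAt_trigVec_coeff (h_deriv S.smooth_c) (h_deriv S.smooth_p)
    (h_deriv S.smooth_q) θ).congr_of_eventuallyEq ?_
  filter_upwards [S.isOpen_I.mem_nhds hs] with σ hσ
  rw [S.d1_X hσ]

theorem hasDerivAt_d1_X_snd (hs : s ∈ S.I) (θ : ℝ) :
    HasDerivAt (fun τ => d1 S.X s τ) (trigVec 0 (deriv S.q s) (-deriv S.p s) θ) θ := by
  rw [S.d1_X hs]
  exact hasDerivAt_trigVec _ _ _ θ

theorem hasDerivAt_d2_X_fst (hs : s ∈ S.I) (θ : ℝ) :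
    HasDerivAt (fun σ => d2 S.X σ θ) (trigVec 0 (deriv S.q s) (-deriv S.p s) θ) s := by
  simp only [d2_X]
  exact hasDerivAt_trigVec_coeff (hasDerivAt_const s 0)
    (hasDerivAt_deriv_of_contDiffOn S.smooth_q S.isOpen_I hs)
    (hasDerivAt_deriv_of_contDiffOn S.smooth_p S.isOpen_I hs).fun_neg θ

theorem hasDerivAt_d2_X_snd (s θ : ℝ) :
    HasDerivAt (fun τ => d2 S.X s τ) (trigVec 0 (-S.p s) (-S.q s) θ) θ := by
  rw [S.d2_X]
  exact hasDerivAt_trigVec _ _ _ θ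

theorem twiceDifferentiableAt_X (hs : s ∈ S.I) (θ : ℝ) : TwiceDifferentiableAt S.X s θ where
  d1_d1 := (S.hasDerivAt_d1_X_fst hs θ).differentiableAt
  d2_d1 := (S.hasDerivAt_d1_X_snd hs θ).differentiableAt
  d1_d2 := (S.hasDerivAt_d2_X_fst hs θ).differentiableAt
  d2_d2 := (S.hasDerivAt_d2_X_snd s θ).differentiableAt
  symm := (S.hasDerivAt_d2_X_fst hs θ).deriv.trans (S.hasDerivAt_d1_X_snd hs θ).deriv.symm

end Parametrization

/-- The anisotropic mean curvature of `S` for the Dirichlet energy is constant along every circle: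
it takes the value `Λ s` on the circle with parameter `s`. As in `IsDirichletCAMC`, this includes
`ν₃ ≠ 0`. -/
def HasCirclewiseDirichletCurvature (Λ : ℝ → ℝ) : Prop :=
  ∀ s ∈ S.I, ∀ θ : ℝ, unitNormal S.X s θ 2 ≠ 0 ∧
    anisotropicMeanCurvature dirichletIntegrand S.X s θ = Λ s

section CurvatureEquation

variable {S} {Λ : ℝ → ℝ}

theorem HasCirclewiseDirichletCurvature.heightLaplacian_eq
    (hS : S.HasCirclewiseDirichletCurvature Λ) (hs : s ∈ S.I) (θ : ℝ) :
    heightLaplacian (trigVec (deriv S.c s) (deriv S.p s) (deriv S.q s) θ)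
        (trigVec 0 (S.q s) (-S.p s) θ)
        (trigVec (deriv (deriv S.c) s) (deriv (deriv S.p) s) (deriv (deriv S.q) s) θ)
        (trigVec 0 (deriv S.q s) (-deriv S.p s) θ) (trigVec 0 (-S.p s) (-S.q s) θ)
      = Λ s / 2 * cross (trigVec (deriv S.c s) (deriv S.p s) (deriv S.q s) θ)
          (trigVec 0 (S.q s) (-S.p s) θ) 2 ^ 3 := by
  obtain ⟨h0, h_curvature⟩ := hS s hs θ
  have h := anisotropicMeanCurvature_dirichlet (S.twiceDifferentiableAt_X hs θ)
    (S.immersed s hs θ) h0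
  rw [h_curvature, show d1 (d1 S.X) s θ = _ from (S.hasDerivAt_d1_X_fst hs θ).deriv,
    show d2 (d1 S.X) s θ = _ from (S.hasDerivAt_d1_X_snd hs θ).deriv,
    show d2 (d2 S.X) s θ = _ from (S.hasDerivAt_d2_X_snd s θ).deriv, S.d1_X hs, S.d2_X] at h
  linarith

theorem HasCirclewiseDirichletCurvature.cross_deriv_p_q
    (hS : S.HasCirclewiseDirichletCurvature Λ) (hs : s ∈ S.I) (hΛ : Λ s ≠ 0) :
    cross (deriv S.p s) (S.p s) 2 = cross (deriv S.q s) (S.q s) 2 ∧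
      cross (deriv S.p s) (S.q s) 2 + cross (deriv S.q s) (S.p s) 2 = 0 := by
  have h_d1 := hasLeadingFourierCoeff_trigVec (deriv S.c s) (deriv S.p s) (deriv S.q s)
  have h_d2 := hasLeadingFourierCoeff_trigVec 0 (S.q s) (-S.p s)
  have h_cube := HasLeadingFourierCoeff.heightLaplacian h_d1 h_d2
    (hasLeadingFourierCoeff_trigVec (deriv (deriv S.c) s) (deriv (deriv S.p) s)
      (deriv (deriv S.q) s))
    (hasLeadingFourierCoeff_trigVec 0 (deriv S.q s) (-deriv S.p s))
    (hasLeadingFourierCoeff_trigVec 0 (-S.p s) (-S.q s))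
  simp only [hS.heightLaplacian_eq hs] at h_cube
  have h_zero := (HasLeadingFourierCoeff.cross h_d1 h_d2 2).eq_zero_of_mul_cube
    (div_ne_zero hΛ two_ne_zero) h_cube
  have h_re := congrArg Complex.re h_zero
  have h_im := congrArg Complex.im h_zero
  simp only [crossProduct, LinearMap.mk₂_apply, Matrix.cons_val, PiLp.neg_apply,
    Complex.ofReal_neg, neg_mul, Complex.sub_re, Complex.mul_re, Complex.div_ofNat_re,
    Complex.add_re, Complex.ofReal_re, Complex.I_re, Complex.ofReal_im, Complex.I_im,
    Complex.neg_re, Complex.div_ofNat_im, Complex.add_im, Complex.mul_im, Complex.neg_im,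
    Complex.zero_re, Complex.sub_im, Complex.zero_im] at h_re h_im
  simp only [cross_apply_two]
  constructor <;> linarith

theorem HasCirclewiseDirichletCurvature.cross_deriv_u_v
    (hS : S.HasCirclewiseDirichletCurvature Λ) (hs : s ∈ S.I) (hΛ : Λ s ≠ 0) :
    cross (deriv S.u s) (S.u s) 2 = cross (deriv S.v s) (S.v s) 2 ∧
      cross (deriv S.u s) (S.v s) 2 + cross (deriv S.v s) (S.u s) 2 = 0 := by
  obtain ⟨h₁, h₂⟩ := hS.cross_deriv_p_q hs hΛ
  have h_r := hasDerivAt_deriv_of_contDiffOn S.smooth_r S.isOpen_I hs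
  have h_p : deriv S.p s = _ :=
    (h_r.fun_smul (hasDerivAt_deriv_of_contDiffOn S.smooth_u S.isOpen_I hs)).deriv
  have h_q : deriv S.q s = _ :=
    (h_r.fun_smul (hasDerivAt_deriv_of_contDiffOn S.smooth_v S.isOpen_I hs)).deriv
  have h_r_sq : S.r s ^ 2 ≠ 0 := pow_ne_zero 2 (S.r_pos s hs).ne'
  simp only [h_p, h_q, p, q, cross_apply_two, PiLp.add_apply, PiLp.smul_apply,
    smul_eq_mul] at h₁ h₂ ⊢
  constructor <;> apply mul_left_cancel₀ h_r_sq <;> linarith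

end CurvatureEquation

section PlaneNormal

theorem hasDerivAt_n (hs : s ∈ S.I) : HasDerivAt S.n (deriv S.n s) s :=
  (differentiableAt_cross
    (hasDerivAt_deriv_of_contDiffOn S.smooth_u S.isOpen_I hs).differentiableAt
    (hasDerivAt_deriv_of_contDiffOn S.smooth_v S.isOpen_I hs).differentiableAt).hasDerivAt

theorem deriv_n (hs : s ∈ S.I) :
    deriv S.n s = -(⟪deriv S.u s, S.n s⟫_ℝ • S.u s + ⟪deriv S.v s, S.n s⟫_ℝ • S.v s) := by
  have h_n : ⟪deriv S.n s, S.n s⟫_ℝ = 0 := by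
    refine inner_deriv_self_eq_zero (k := 1) (S.hasDerivAt_n hs) ?_
    filter_upwards [S.isOpen_I.mem_nhds hs] with t ht
    exact norm_cross_of_orthonormal (S.orthonormal t ht)
  have h_u : ⟪deriv S.u s, S.n s⟫_ℝ = -⟪S.u s, deriv S.n s⟫_ℝ :=
    inner_deriv_eq_neg (k := 0) (hasDerivAt_deriv_of_contDiffOn S.smooth_u S.isOpen_I hs)
      (S.hasDerivAt_n hs) (.of_forall fun x => by rw [real_inner_comm, n, inner_cross_left])
  have h_v : ⟪deriv S.v s, S.n s⟫_ℝ = -⟪S.v s, deriv S.n s⟫_ℝ :=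
    inner_deriv_eq_neg (k := 0) (hasDerivAt_deriv_of_contDiffOn S.smooth_v S.isOpen_I hs)
      (S.hasDerivAt_n hs) (.of_forall fun x => by rw [real_inner_comm, n, inner_cross_right])
  have h_sum := eq_sum_of_orthonormal (S.orthonormal s hs) (deriv S.n s)
  rw [← n, h_n, real_inner_comm (S.u s), real_inner_comm (S.v s)] at h_sum
  rw [h_sum, h_u, h_v]
  module

end PlaneNormal

section ParallelPlanes

variable {S} {Λ : ℝ → ℝ}

theorem HasCirclewiseDirichletCurvature.deriv_n_eq_zero_or_horizontal
    (hS : S.HasCirclewiseDirichletCurvature Λ) (hs : s ∈ S.I) (hΛ : Λ s ≠ 0) :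
    deriv S.n s = 0 ∨ S.u s 2 = 0 ∧ S.v s 2 = 0 := by
  have h_near : ∀ᶠ t in 𝓝 s, t ∈ S.I := S.isOpen_I.mem_nhds hs
  have h_u := hasDerivAt_deriv_of_contDiffOn S.smooth_u S.isOpen_I hs
  have h_v := hasDerivAt_deriv_of_contDiffOn S.smooth_v S.isOpen_I hs
  have h_frame {t : ℝ} (ht : t ∈ S.I) := orthonormal_pair_iff.1 (S.orthonormal t ht)
  have h_u_u : ⟪deriv S.u s, S.u s⟫_ℝ = 0 :=
    inner_deriv_self_eq_zero h_u (h_near.mono fun t ht => (h_frame ht).1)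
  have h_v_v : ⟪deriv S.v s, S.v s⟫_ℝ = 0 :=
    inner_deriv_self_eq_zero h_v (h_near.mono fun t ht => (h_frame ht).2.1)
  have h_u_v : ⟪deriv S.u s, S.v s⟫_ℝ = -⟪deriv S.v s, S.u s⟫_ℝ := by
    rw [real_inner_comm (S.u s)]
    exact inner_deriv_eq_neg h_u h_v (h_near.mono fun t ht => (h_frame ht).2.2)
  obtain ⟨h₁, h₂⟩ := hS.cross_deriv_u_v hs hΛ
  have h_left := cross_left_apply_two_of_orthonormal (S.orthonormal s hs)
  have h_right := cross_right_apply_two_of_orthonormal (S.orthonormal s hs)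
  rw [h_left, h_right (deriv S.v s), h_u_v] at h₁
  rw [h_right (deriv S.u s), h_left, h_u_u, h_v_v] at h₂
  have h_product : (⟨⟪deriv S.u s, S.n s⟫_ℝ, ⟪deriv S.v s, S.n s⟫_ℝ⟩ : ℂ)
      * ⟨S.u s 2, S.v s 2⟩ = 0 := by
    apply Complex.ext
    · simp only [Complex.mul_re, Complex.zero_re, n]
      linarith
    · simp only [Complex.mul_im, Complex.zero_im, n]
      linarith
  rcases mul_eq_zero.1 h_product with h_zero | h_zero
  · obtain ⟨h_re, h_im⟩ := Complex.ext_iff.1 h_zero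
    left
    rw [S.deriv_n hs, show ⟪deriv S.u s, S.n s⟫_ℝ = 0 from h_re,
      show ⟪deriv S.v s, S.n s⟫_ℝ = 0 from h_im]
    simp
  · exact Or.inr (Complex.ext_iff.1 h_zero)

theorem HasCirclewiseDirichletCurvature.n_apply_two_eq
    (hS : S.HasCirclewiseDirichletCurvature Λ) (hΛ : ∀ s ∈ S.I, Λ s ≠ 0) {t : ℝ} (hs : s ∈ S.I)
    (ht : t ∈ S.I) : S.n s 2 = S.n t 2 := by
  refine eq_of_hasDerivAt_zero (f := fun x => S.n x 2) S.isOpen_I S.ordConnected_I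
    (fun x hx => (E3.hasDerivAt_apply (S.hasDerivAt_n hx) 2).congr_deriv ?_) hs ht
  rcases hS.deriv_n_eq_zero_or_horizontal hx (hΛ x hx) with h_zero | ⟨hu, hv⟩
  · rw [h_zero, PiLp.zero_apply]
  · simp [S.deriv_n hx, hu, hv]

theorem HasCirclewiseDirichletCurvature.n_eq
    (hS : S.HasCirclewiseDirichletCurvature Λ) (hΛ : ∀ s ∈ S.I, Λ s ≠ 0) {t : ℝ} (hs : s ∈ S.I)
    (ht : t ∈ S.I) : S.n s = S.n t := by
  have h_slope {x : ℝ} (hx : x ∈ S.I) : S.u x 2 ^ 2 + S.v x 2 ^ 2 = 1 - S.n s 2 ^ 2 := by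
    rw [← hS.n_apply_two_eq hΛ hx hs, n, ← cross_apply_two_sq_add (S.orthonormal x hx)]
    ring
  rcases eq_or_ne (1 - S.n s 2 ^ 2) 0 with h_horizontal | h_tilted
  · have h_e3 {x : ℝ} (hx : x ∈ S.I) : e3 = S.n s 2 • S.n x := by
      have h_zero := h_slope hx
      rw [h_horizontal, add_eq_zero_iff_of_nonneg (sq_nonneg _) (sq_nonneg _), sq_eq_zero_iff,
        sq_eq_zero_iff] at h_zero
      have h_sum := eq_sum_of_orthonormal (S.orthonormal x hx) e3
      rwa [E3.inner_e3_left, E3.inner_e3_left, E3.inner_e3_left, h_zero.1, h_zero.2, zero_smul,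
        zero_smul, add_zero, add_zero, ← n, hS.n_apply_two_eq hΛ hx hs] at h_sum
    have h_ne : S.n s 2 ≠ 0 := fun h0 => by norm_num [h0] at h_horizontal
    exact smul_right_injective E3 h_ne ((h_e3 hs).symm.trans (h_e3 ht))
  · refine eq_of_hasDerivAt_zero S.isOpen_I S.ordConnected_I (fun x hx => ?_) hs ht
    have h_zero := (hS.deriv_n_eq_zero_or_horizontal hx (hΛ x hx)).resolve_right
      fun ⟨hu, hv⟩ => h_tilted (by rw [← h_slope hx, hu, hv]; norm_num)
    exact h_zero ▸ S.hasDerivAt_n hx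

variable (S) in
theorem direction_plane (hs : s ∈ S.I) :
    (S.plane s).direction = (Submodule.span ℝ {S.n s})ᗮ := by
  rw [plane, AffineSubspace.direction_mk', span_pair_eq_orthogonal_cross (S.orthonormal s hs), n]

theorem HasCirclewiseDirichletCurvature.plane_parallel
    (hS : S.HasCirclewiseDirichletCurvature Λ) (hΛ : ∀ s ∈ S.I, Λ s ≠ 0) {t : ℝ} (hs : s ∈ S.I)
    (ht : t ∈ S.I) : (S.plane s).Parallel (S.plane t) := by
  have h_ne (x : ℝ) : S.plane x ≠ ⊥ :=
    (AffineSubspace.nonempty_iff_ne_bot _).1 ⟨_, AffineSubspace.self_mem_mk' _ _⟩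
  rw [AffineSubspace.parallel_iff_direction_eq_and_eq_bot_iff_eq_bot, S.direction_plane hs,
    S.direction_plane ht, hS.n_eq hΛ hs ht]
  exact ⟨rfl, iff_of_false (h_ne s) (h_ne t)⟩

end ParallelPlanes

end CyclicSurface

namespace ParamSurface

section Horizontal

theorem heightLaplacian_eq_of_horizontal {a b xss xsθ xθθ : E3} (hb : b 2 = 0) (hsθ : xsθ 2 = 0)
    (hθθ : xθθ 2 = 0) :
    heightLaplacian a b xss xsθ xθθ
      = (xss 2 * cross a b 2 + a 2 * cross b xss 2) * (b 0 ^ 2 + b 1 ^ 2)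
        - 2 * (a 2 * cross b xsθ 2) * (a 0 * b 0 + a 1 * b 1)
        + a 2 * cross b xθθ 2 * (a 0 ^ 2 + a 1 ^ 2) := by
  simp only [heightLaplacian, E3.inner_eq, cross_apply_zero, cross_apply_one, cross_apply_two, hb,
    hsθ, hθθ]
  ring

variable {p q p' q' : E3}

theorem cross_trigVec_apply_two (f : E3) (h₁ : cross p' p 2 = cross q' q 2)
    (h₂ : cross p' q 2 + cross q' p 2 = 0) (θ : ℝ) :
    cross (trigVec f p' q' θ) (trigVec 0 q (-p) θ) 2
      = cross p' q 2 + (Real.cos θ * cross f q 2 + Real.sin θ * -cross f p 2) := by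
  simp only [cross_apply_two, trigVec_apply, PiLp.zero_apply, PiLp.neg_apply] at h₁ h₂ ⊢
  linear_combination (p' 0 * q 1 - p' 1 * q 0) * Real.cos_sq_add_sin_sq θ
    - Real.cos θ * Real.sin θ * h₁ - Real.sin θ ^ 2 * h₂

theorem cross_trigVec_zero_apply_two (h₁ : cross p' p 2 = cross q' q 2)
    (h₂ : cross p' q 2 + cross q' p 2 = 0) (θ : ℝ) :
    cross (trigVec 0 q (-p) θ) (trigVec 0 q' (-p') θ) 2 = cross q q' 2 := by
  simp only [cross_apply_two, trigVec_apply, PiLp.zero_apply, PiLp.neg_apply] at h₁ h₂ ⊢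
  linear_combination (q 0 * q' 1 - q 1 * q' 0) * Real.cos_sq_add_sin_sq θ
    - Real.sin θ ^ 2 * h₁ + Real.cos θ * Real.sin θ * h₂

end Horizontal

end ParamSurface

theorem HasLeadingFourierCoeff.heightLaplacian_of_horizontal {a b xss xsθ xθθ : ℝ → E3}
    {α β γ : Fin 3 → ℂ} (ha : ∀ i, HasLeadingFourierCoeff 1 (fun θ => a θ i) (α i))
    (hb : ∀ i, HasLeadingFourierCoeff 1 (fun θ => b θ i) (β i))
    (hss : ∀ i, HasLeadingFourierCoeff 1 (fun θ => xss θ i) (γ i)) {k k' ρ l m : ℝ}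
    (ha₂ : ∀ θ, a θ 2 = k) (hss₂ : ∀ θ, xss θ 2 = k') (hb₂ : ∀ θ, b θ 2 = 0)
    (hsθ₂ : ∀ θ, xsθ θ 2 = 0) (hθθ₂ : ∀ θ, xθθ θ 2 = 0) (h_norm : ∀ θ, b θ 0 ^ 2 + b θ 1 ^ 2 = ρ)
    (h_cross_sθ : ∀ θ, cross (b θ) (xsθ θ) 2 = l)
    (h_cross_θθ : ∀ θ, cross (b θ) (xθθ θ) 2 = m) :
    HasLeadingFourierCoeff 3
      (fun θ => heightLaplacian (a θ) (b θ) (xss θ) (xsθ θ) (xθθ θ)) 0 := by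
  simp only [heightLaplacian_eq_of_horizontal (hb₂ _) (hsθ₂ _) (hθθ₂ _), ha₂, hss₂, h_norm,
    h_cross_sθ, h_cross_θθ, mul_comm _ ρ]
  have h_ss := (((HasLeadingFourierCoeff.cross ha hb 2).const_mul k').add
    ((HasLeadingFourierCoeff.cross hb hss 2).const_mul k)).const_mul ρ
  have h_sθ := (((ha 0).mul (hb 0)).add ((ha 1).mul (hb 1))).const_mul (2 * (k * l))
  have h_θθ := (((ha 0).pow 2).add ((ha 1).pow 2)).const_mul (k * m)
  exact ((h_ss.sub h_sθ).add h_θθ).raise (by norm_num)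

section HorizontalPlanes

theorem deriv_apply_eq_zero {f : ℝ → E3} {I : Set ℝ} {i : Fin 3} {s : ℝ} (hI : IsOpen I)
    (hf : ContDiffOn ℝ ∞ f I) (h : ∀ t ∈ I, f t i = 0) (hs : s ∈ I) : deriv f s i = 0 := by
  have h_apply := E3.hasDerivAt_apply (hasDerivAt_deriv_of_contDiffOn hf hI hs) i
  refine h_apply.unique ((hasDerivAt_const s 0).congr_of_eventuallyEq ?_)
  filter_upwards [hI.mem_nhds hs] with t ht using h t ht

namespace CyclicSurface

variable {S : CyclicSurface} {Λ : ℝ → ℝ} {s : ℝ}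

theorem trigVec_p_q_apply_sq_add (hs : s ∈ S.I) (hu : S.u s 2 = 0) (hv : S.v s 2 = 0) (θ : ℝ) :
    trigVec 0 (S.q s) (-S.p s) θ 0 ^ 2 + trigVec 0 (S.q s) (-S.p s) θ 1 ^ 2 = S.r s ^ 2 := by
  have h_norm := norm_sq_smul_add_smul_of_orthonormal (S.orthonormal s hs)
    (-(Real.sin θ * S.r s)) (Real.cos θ * S.r s)
  rw [EuclideanSpace.real_norm_sq_eq, Fin.sum_univ_three] at h_norm
  simp only [PiLp.add_apply, PiLp.smul_apply, PiLp.neg_apply, PiLp.zero_apply, trigVec_apply, p, q,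
    smul_eq_mul, hu, hv] at h_norm ⊢
  linear_combination h_norm + S.r s ^ 2 * Real.cos_sq_add_sin_sq θ

theorem HasCirclewiseDirichletCurvature.cross_deriv_c_eq_zero
    (hS : S.HasCirclewiseDirichletCurvature Λ) (h : ∀ t ∈ S.I, S.u t 2 = 0 ∧ S.v t 2 = 0)
    (hs : s ∈ S.I) (hΛ : Λ s ≠ 0) :
    cross (deriv S.c s) (S.p s) 2 = 0 ∧ cross (deriv S.c s) (S.q s) 2 = 0 := by
  obtain ⟨h₁, h₂⟩ := hS.cross_deriv_p_q hs hΛ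
  have hp : ∀ t ∈ S.I, S.p t 2 = 0 := fun t ht => by simp [p, (h t ht).1]
  have hq : ∀ t ∈ S.I, S.q t 2 = 0 := fun t ht => by simp [q, (h t ht).2]
  have hp' : ∀ t ∈ S.I, deriv S.p t 2 = 0 := fun t =>
    deriv_apply_eq_zero S.isOpen_I S.smooth_p hp
  have hq' : ∀ t ∈ S.I, deriv S.q t 2 = 0 := fun t =>
    deriv_apply_eq_zero S.isOpen_I S.smooth_q hq
  have hp'' := deriv_apply_eq_zero S.isOpen_I
    (S.smooth_p.deriv_of_isOpen S.isOpen_I (by simp)) hp' hs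
  have hq'' := deriv_apply_eq_zero S.isOpen_I
    (S.smooth_q.deriv_of_isOpen S.isOpen_I (by simp)) hq' hs
  have h_θθ := cross_trigVec_zero_apply_two (p := S.p s) (q := S.q s) (p' := S.q s)
    (q' := -S.p s) (by simp only [cross_apply_two, PiLp.neg_apply]; ring)
    (by simp only [cross_apply_two, PiLp.neg_apply]; ring)
  have h_cube := HasLeadingFourierCoeff.heightLaplacian_of_horizontal
    (hasLeadingFourierCoeff_trigVec (deriv S.c s) (deriv S.p s) (deriv S.q s))
    (hasLeadingFourierCoeff_trigVec 0 (S.q s) (-S.p s))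
    (hasLeadingFourierCoeff_trigVec (deriv (deriv S.c) s) (deriv (deriv S.p) s)
      (deriv (deriv S.q) s))
    (k := deriv S.c s 2) (k' := deriv (deriv S.c) s 2)
    (xsθ := trigVec 0 (deriv S.q s) (-deriv S.p s)) (xθθ := trigVec 0 (-S.p s) (-S.q s))
    (by simp [trigVec_apply, hp' s hs, hq' s hs]) (by simp [trigVec_apply, hp'', hq''])
    (by simp [trigVec_apply, hp s hs, hq s hs]) (by simp [trigVec_apply, hp' s hs, hq' s hs])
    (by simp [trigVec_apply, hp s hs, hq s hs])
    (trigVec_p_q_apply_sq_add hs (h s hs).1 (h s hs).2)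
    (cross_trigVec_zero_apply_two h₁ h₂) h_θθ
  simp only [hS.heightLaplacian_eq hs, cross_trigVec_apply_two _ h₁ h₂] at h_cube
  have h_zero := (HasLeadingFourierCoeff.linear _ _ _).eq_zero_of_mul_cube
    (div_ne_zero hΛ two_ne_zero) h_cube
  simpa [Complex.ext_iff, and_comm] using h_zero

theorem HasCirclewiseDirichletCurvature.deriv_c_apply_eq_zero
    (hS : S.HasCirclewiseDirichletCurvature Λ) (h : ∀ t ∈ S.I, S.u t 2 = 0 ∧ S.v t 2 = 0)
    (hs : s ∈ S.I) (hΛ : Λ s ≠ 0) : deriv S.c s 0 = 0 ∧ deriv S.c s 1 = 0 := by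
  obtain ⟨hu, hv⟩ := h s hs
  obtain ⟨h_p, h_q⟩ := hS.cross_deriv_c_eq_zero h hs hΛ
  have h_r := (S.r_pos s hs).ne'
  have h_n : S.n s 2 ≠ 0 := fun h0 => by
    have h_sq := cross_apply_two_sq_add (S.orthonormal s hs)
    rw [← n, h0, hu, hv] at h_sq
    norm_num at h_sq
  simp only [n, p, q, cross_apply_two, PiLp.smul_apply, smul_eq_mul] at h_p h_q h_n
  constructor <;> apply mul_left_cancel₀ (mul_ne_zero h_r h_n)
  · linear_combination S.u s 0 * h_q - S.v s 0 * h_p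
  · linear_combination S.u s 1 * h_q - S.v s 1 * h_p

theorem HasCirclewiseDirichletCurvature.c_sub_mem_span_e3
    (hS : S.HasCirclewiseDirichletCurvature Λ) (hΛ : ∀ s ∈ S.I, Λ s ≠ 0)
    (h : ∀ t ∈ S.I, S.u t 2 = 0 ∧ S.v t 2 = 0) {t : ℝ} (hs : s ∈ S.I) (ht : t ∈ S.I) :
    S.c s - S.c t ∈ Submodule.span ℝ {e3} := by
  have h_c {x : ℝ} (hx : x ∈ S.I) (i : Fin 3) : HasDerivAt (fun y => S.c y i) (deriv S.c x i) x :=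
    E3.hasDerivAt_apply (hasDerivAt_deriv_of_contDiffOn S.smooth_c S.isOpen_I hx) i
  have h_zero {x : ℝ} (hx : x ∈ S.I) := hS.deriv_c_apply_eq_zero h hx (hΛ x hx)
  rw [E3.mem_span_e3_iff, PiLp.sub_apply, PiLp.sub_apply, sub_eq_zero, sub_eq_zero]
  exact ⟨eq_of_hasDerivAt_zero S.isOpen_I S.ordConnected_I
      (fun x hx => (h_zero hx).1 ▸ h_c hx 0) hs ht,
    eq_of_hasDerivAt_zero S.isOpen_I S.ordConnected_I
      (fun x hx => (h_zero hx).2 ▸ h_c hx 1) hs ht⟩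

theorem direction_plane_of_parallel_xyPlane (h : (S.plane s).Parallel xyPlane) :
    (S.plane s).direction = (Submodule.span ℝ {e3})ᗮ := by
  rw [h.direction_eq, xyPlane, AffineSubspace.direction_mk']

theorem horizontal_of_direction_plane (h : (S.plane s).direction = (Submodule.span ℝ {e3})ᗮ) :
    S.u s 2 = 0 ∧ S.v s 2 = 0 := by
  have h_apply {w : E3} (hw : w ∈ (S.plane s).direction) : w 2 = 0 := by
    rwa [h, Submodule.mem_orthogonal_singleton_iff_inner_right, E3.inner_e3_left] at hw
  rw [plane, AffineSubspace.direction_mk'] at h_apply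
  exact ⟨h_apply (Submodule.subset_span (by simp)), h_apply (Submodule.subset_span (by simp))⟩

end CyclicSurface

end HorizontalPlanes

section SurfaceOfRevolution

namespace CyclicSurface

variable {S : CyclicSurface} {x y d : E3}

theorem mem_carrier_iff :
    x ∈ S.carrier ↔ ∃ s ∈ S.I, ∃ w ∈ (S.plane s).direction, ‖w‖ = 1 ∧ x = S.c s + S.r s • w := by
  refine exists_congr fun s => and_congr_right fun hs => ?_
  simp only [plane, AffineSubspace.direction_mk', ← and_assoc,
    ← exists_eq_cos_smul_add_sin_smul_iff (S.orthonormal s hs)]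
  constructor
  · rintro ⟨θ, rfl⟩
    exact ⟨_, ⟨θ, rfl⟩, rfl⟩
  · rintro ⟨_, ⟨θ, rfl⟩, rfl⟩
    exact ⟨θ, rfl⟩

theorem rotation_mem_carrier
    (h : ∀ s ∈ S.I, S.c s ∈ AffineSubspace.mk' y (Submodule.span ℝ {d}) ∧
      (S.plane s).direction = (Submodule.span ℝ {d})ᗮ)
    {ρ : E3 ≃ₗᵢ[ℝ] E3} (hρ : ρ d = d) (hx : x ∈ S.carrier) : y + ρ (x - y) ∈ S.carrier := by
  obtain ⟨s, hs, w, hw, h_norm, rfl⟩ := mem_carrier_iff.1 hx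
  obtain ⟨h_axis, h_plane⟩ := h s hs
  rw [AffineSubspace.mem_mk', vsub_eq_sub, Submodule.mem_span_singleton] at h_axis
  obtain ⟨k, hk⟩ := h_axis
  refine mem_carrier_iff.2 ⟨s, hs, ρ w, ?_, by rw [ρ.norm_map, h_norm], ?_⟩
  · rw [h_plane, Submodule.mem_orthogonal_singleton_iff_inner_right] at hw ⊢
    rw [← hρ, ρ.inner_map_map, hw]
  · have h_center : ρ (S.c s - y) = S.c s - y := by rw [← hk, map_smul, hρ]
    rw [add_sub_right_comm, map_add, h_center, map_smul]
    abel

theorem isSurfaceOfRevolutionAbout_of_coaxial (hd : d ≠ 0)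
    (h : ∀ s ∈ S.I, S.c s ∈ AffineSubspace.mk' y (Submodule.span ℝ {d}) ∧
      (S.plane s).direction = (Submodule.span ℝ {d})ᗮ) : S.IsSurfaceOfRevolutionAbout y d := by
  refine ⟨hd, fun ρ _ hρ => Set.Subset.antisymm ?_ fun x hx => ?_, h⟩
  · rintro _ ⟨x, hx, rfl⟩
    exact rotation_mem_carrier h hρ hx
  · refine ⟨y + ρ.symm (x - y), rotation_mem_carrier h ?_ hx, ?_⟩
    · rw [LinearIsometryEquiv.symm_apply_eq, hρ]
    · simp

end CyclicSurface

end SurfaceOfRevolution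

theorem theorem1p5_general (S : CyclicSurface) (Λ : ℝ → ℝ) (hΛ : ∀ s ∈ S.I, Λ s ≠ 0)
    (hS : S.HasCirclewiseDirichletCurvature Λ) :
    (∀ s ∈ S.I, ∀ t ∈ S.I, (S.plane s).Parallel (S.plane t)) ∧
    ((∀ s ∈ S.I, (S.plane s).Parallel xyPlane) →
      ∃ p : E3, S.IsSurfaceOfRevolutionAbout p e3) := by
  refine ⟨fun s hs t ht => hS.plane_parallel hΛ hs ht, fun h_parallel => ?_⟩
  obtain ⟨s₀, hs₀⟩ := S.nonempty_I
  have h_direction (s : ℝ) (hs : s ∈ S.I) :=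
    CyclicSurface.direction_plane_of_parallel_xyPlane (h_parallel s hs)
  have h_horizontal (s : ℝ) (hs : s ∈ S.I) :=
    CyclicSurface.horizontal_of_direction_plane (h_direction s hs)
  have h_axis (s : ℝ) (hs : s ∈ S.I) :
      S.c s ∈ AffineSubspace.mk' (S.c s₀) (Submodule.span ℝ {e3}) :=
    AffineSubspace.mem_mk'.2 (hS.c_sub_mem_span_e3 hΛ h_horizontal hs hs₀)
  have h_e3 : e3 ≠ 0 := by simp [e3]
  exact ⟨S.c s₀, CyclicSurface.isSurfaceOfRevolutionAbout_of_coaxial h_e3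
    fun s hs => ⟨h_axis s hs, h_direction s hs⟩⟩

theorem theorem1p5 (S : CyclicSurface) (Λ : ℝ) (hΛ : Λ ≠ 0) (hS : S.IsDirichletCAMC Λ) :
    (∀ s ∈ S.I, ∀ t ∈ S.I, (S.plane s).Parallel (S.plane t)) ∧
    ((∀ s ∈ S.I, (S.plane s).Parallel xyPlane) →
      ∃ p : E3, S.IsSurfaceOfRevolutionAbout p e3) :=
  theorem1p5_general S (fun _ => Λ) (fun _ _ => hΛ) hS
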